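/- Let $(X,d,\mu)$ be a complete metric space with a Borel measure $\mu$ that is doubling, i.e. there is $C_d>1$ such that $0<\mu(B(x,2r))\le C_d\,\mu(B(x,r))<\infty$ for all $x\in X$, $r>0$, where $B(x,r)$ denotes the open ball. Assume that $X$ satisfies an annular decay property: there are $0\le\alpha\le 1$ and $C\ge 1$ such that $$\mu\big(B(x,r)\setminus B(x,(1-\delta)r)\big)\le C\,\delta^{\alpha}\,\mu(B(x,r))$$ for all $x\in X$, $r>0$ and $0<\delta<1$. Write $f_B=\mu(B)^{-1}\int_B f\,d\mu$ for the average of $f$ over a ball $B$. Let $A_\infty(X)$ be the class of locally integrable functions $w$ that are positive almost everywhere, with $\log w$ integrable on every ball, such that $$\sup_{B} w_B\,\exp\big(-(\log w)_B\big)<\infty,$$ and let $RH_\infty(X)$ be the class of nonnegative locally integrable functions $w$ for which there is a constant $C<\infty$ such that $\operatorname{ess\,sup}_{B}w\le C\,w_B$ for every ball $B$ (the supremum and the condition ranging over all open balls of positive radius). A function $\varphi$ is called a multiplier of $RH_\infty(X)$ if $\varphi w\in RH_\infty(X)$ for every $w\in RH_\infty(X)$. Then a function $\varphi\in A_\infty(X)$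 is a multiplier of $RH_\infty(X)$ if and only if $\varphi\in RH_\infty(X)$. -/

import Mathlib

open MeasureTheory Metric

noncomputable section

variable {X : Type*} [MetricSpace X] [MeasurableSpace X]

/-- `μ` is doubling: there is `C_d > 1` with `0 < μ (2B) ≤ C_d μ(B) < ∞` for all open balls `B`. -/
def IsDoubling (μ : Measure X) : Prop :=
  ∃ Cd : ℝ, 1 < Cd ∧ ∀ (x : X) (r : ℝ), 0 < r →
    0 < μ (ball x (2 * r)) ∧
    μ (ball x (2 * r)) ≤ ENNReal.ofReal Cd * μ (ball x r) ∧
    ENNReal.ofReal Cd * μ (ball x r) < ⊤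

/-- The `α`-annular decay property. -/
def AnnularDecay (μ : Measure X) (α : ℝ) : Prop :=
  ∃ C : ℝ, 1 ≤ C ∧ ∀ (x : X) (r δ : ℝ), 0 < r → 0 < δ → δ < 1 →
    μ (ball x r \ ball x ((1 - δ) * r)) ≤ ENNReal.ofReal (C * δ ^ α) * μ (ball x r)

/-- An annular decay property: `α`-annular decay for some `0 ≤ α ≤ 1`. -/
def HasAnnularDecay (μ : Measure X) : Prop :=
  ∃ α : ℝ, 0 ≤ α ∧ α ≤ 1 ∧ AnnularDecay μ α

/-- The class `A_∞`, given by the reverse Jensen inequality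
`sup_B (⨍_B w) exp (-⨍_B log w) < ∞`.
Finiteness of the supremum means that `⨍_B log w` is never `-∞`; since `Real.log 0 = 0` and the
integral of a non-integrable function is `0` in Mathlib, this is spelled out as positivity a.e.
and integrability of `log w` on balls (`log⁺ w ≤ w` is always integrable there). -/
structure MemAInfty (μ : Measure X) (w : X → ℝ) : Prop where
  locallyIntegrable : LocallyIntegrable w μ
  pos : ∀ᵐ x ∂μ, 0 < w x
  log_integrableOn : ∀ (x : X) (r : ℝ), 0 < r →
    IntegrableOn (fun y => Real.log (w y)) (ball x r) μ
  reverse_jensen : ∃ C : ℝ, ∀ (x : X) (r : ℝ), 0 < r →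
    (⨍ y in ball x r, w y ∂μ) * Real.exp (-⨍ y in ball x r, Real.log (w y) ∂μ) ≤ C

/-- The class `RH_∞`: `esssup_B w ≤ C ⨍_B w` for all balls `B`. The essential supremum is taken
in `[0, ∞]`, so that it is `∞` for essentially unbounded functions. -/
structure MemRHInfty (μ : Measure X) (w : X → ℝ) : Prop where
  locallyIntegrable : LocallyIntegrable w μ
  nonneg : ∀ᵐ x ∂μ, 0 ≤ w x
  reverse_holder : ∃ C : ℝ, ∀ (x : X) (r : ℝ), 0 < r →
    essSup (fun y => ENNReal.ofReal (w y)) (μ.restrict (ball x r)) ≤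
      ENNReal.ofReal (C * ⨍ y in ball x r, w y ∂μ)

/-- `φ` is a multiplier of `RH_∞`: `φ w ∈ RH_∞` for all `w ∈ RH_∞`. -/
def IsMultiplierRHInfty (μ : Measure X) (φ : X → ℝ) : Prop :=
  ∀ w : X → ℝ, MemRHInfty μ w → MemRHInfty μ (fun x => φ x * w x)

end

/-! Necessity: the constant 1 lies in `RH_∞`. Sufficiency: on a ball, `φ w` is at most a constant
times the product of the two means, so it remains to bound that product by the mean of `φ w`. With
`m` the mean of `φ`, the `A_∞` condition bounds the mean of `g = φ/m - log (φ/m)`, and `φ/m ≥ exp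
(-g)`. Since `w` is at most `K` times its mean, the `w`-weighted mean of `g` is bounded too, and
Jensen's inequality for the weight `w` gives `exp_mul_integral_mul_integral_le`. -/

/-- Quantitative decoupling: under the reverse Jensen inequality for `φ` and the bound `w ≤ K ∫ w`,
the mean of `φ w` controls the product of the means. -/
theorem exp_mul_integral_mul_integral_le {Ω : Type*} [MeasurableSpace Ω] {P : Measure Ω}
    [IsProbabilityMeasure P] {φ w : Ω → ℝ} {C K : ℝ}
    (hφ : Integrable φ P) (hφ_pos : ∀ᵐ x ∂P, 0 < φ x)
    (hlog : Integrable (fun x => Real.log (φ x)) P)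
    (hC : (∫ x, φ x ∂P) * Real.exp (-∫ x, Real.log (φ x) ∂P) ≤ C)
    (hw : Integrable w P) (hw_nonneg : ∀ᵐ x ∂P, 0 ≤ w x)
    (hw_le : ∀ᵐ x ∂P, w x ≤ K * ∫ y, w y ∂P)
    (hφw : Integrable (fun x => φ x * w x) P) :
    Real.exp (-(K * (1 + Real.log C))) * ((∫ x, φ x ∂P) * ∫ x, w x ∂P) ≤
      ∫ x, φ x * w x ∂P := by
  set m := ∫ x, φ x ∂P with hm
  set v := ∫ x, w x ∂P with hv
  set l := ∫ x, Real.log (φ x) ∂P with hl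
  have hm_pos : 0 < m := by
    have h0 : 0 ≤ m := integral_nonneg_of_ae (hφ_pos.mono fun x hx => hx.le)
    refine lt_of_le_of_ne h0 fun h => ?_
    have hz := (integral_eq_zero_iff_of_nonneg_ae (hφ_pos.mono fun x hx => hx.le) hφ).1 h.symm
    obtain ⟨x, hx, hx'⟩ := (hφ_pos.and hz).exists
    exact hx.ne' hx'
  have hv_nonneg : 0 ≤ v := integral_nonneg_of_ae hw_nonneg
  have hKv : 0 ≤ K * v := by
    obtain ⟨x, hx, hx'⟩ := (hw_nonneg.and hw_le).exists
    exact hx.trans hx'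
  -- Upper bound for the `w`-weighted mean of `g`.
  set t := K * (1 + Real.log C) with ht
  -- `g = φ / m - log (φ / m)` is positive, with mean at most `1 + log C`
  set g : Ω → ℝ := fun x => φ x / m - (Real.log (φ x) - Real.log m) with hg
  have hlog_sub : Integrable (fun x => Real.log (φ x) - Real.log m) P :=
    hlog.sub (integrable_const _)
  have hg_int : Integrable g P := (hφ.div_const m).sub hlog_sub
  have hg_mean : ∫ x, g x ∂P ≤ 1 + Real.log C := by
    have h1 : ∫ x, g x ∂P = 1 - (l - Real.log m) := by
      rw [integral_sub (hφ.div_const m) hlog_sub,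
        integral_sub hlog (integrable_const _), integral_div, ← hm, ← hl, div_self hm_pos.ne']
      simp
    have h2 := Real.log_le_log (mul_pos hm_pos (Real.exp_pos _)) hC
    rw [Real.log_mul hm_pos.ne' (Real.exp_pos _).ne', Real.log_exp] at h2
    linarith
  have hpt : ∀ᵐ x ∂P, Real.exp (-t) * m * ((1 + t) * w x - K * v * g x) ≤ φ x * w x := by
    filter_upwards [hφ_pos, hw_nonneg, hw_le] with x hφx hwx hwx'
    have hratio : 0 < φ x / m := div_pos hφx hm_pos
    have hg_eq : g x = φ x / m - Real.log (φ x / m) := by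
      simp only [hg, Real.log_div hφx.ne' hm_pos.ne']
    have hg_nonneg : 0 ≤ g x := by
      have := Real.log_le_sub_one_of_pos hratio
      linarith
    -- Jensen in linearised form: the tangent to `exp` at `-t` lies below `exp (-g)`. This avoids
    -- dividing by `v`, which may vanish.
    have h1 : Real.exp (-t) * (1 + t - g x) ≤ φ x / m := by
      calc Real.exp (-t) * (1 + t - g x)
          ≤ Real.exp (-t) * Real.exp (t - g x) := by
            gcongr
            linarith [Real.add_one_le_exp (t - g x)]
        _ = Real.exp (-g x) := by rw [← Real.exp_add]; ring_nf
        _ ≤ Real.exp (Real.log (φ x / m)) := Real.exp_le_exp.2 (by linarith)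
        _ = φ x / m := Real.exp_log hratio
    rw [le_div_iff₀ hm_pos] at h1
    calc Real.exp (-t) * m * ((1 + t) * w x - K * v * g x)
        ≤ Real.exp (-t) * m * ((1 + t) * w x - w x * g x) := by gcongr
      _ = Real.exp (-t) * (1 + t - g x) * m * w x := by ring
      _ ≤ φ x * w x := by gcongr
  have hint := integral_mono_ae
    (((hw.const_mul (1 + t)).sub (hg_int.const_mul (K * v))).const_mul (Real.exp (-t) * m)) hφw hpt
  refine le_trans ?_ hint
  rw [integral_const_mul, integral_sub' (hw.const_mul _) (hg_int.const_mul _), integral_const_mul,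
    integral_const_mul, ← hv, mul_assoc]
  have h3 := mul_le_mul_of_nonneg_left hg_mean hKv
  have h4 : v ≤ (1 + t) * v - K * v * ∫ x, g x ∂P := by
    have : t * v = K * v * (1 + Real.log C) := by rw [ht]; ring
    linarith
  gcongr

section

variable {X : Type*} [MetricSpace X] [MeasurableSpace X] {μ : Measure X} {w φ : X → ℝ}

theorem IsDoubling.measure_ball_pos (hμ : IsDoubling μ) (x : X) {r : ℝ} (hr : 0 < r) :
    0 < μ (ball x r) := by
  obtain ⟨Cd, -, h⟩ := hμ
  have := (h x (r / 2) (by positivity)).1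
  rwa [mul_div_cancel₀ r two_ne_zero] at this

theorem IsDoubling.measure_ball_lt_top (hμ : IsDoubling μ) (x : X) {r : ℝ} (hr : 0 < r) :
    μ (ball x r) < ⊤ := by
  obtain ⟨Cd, hCd, h⟩ := hμ
  refine lt_top_iff_ne_top.2 fun htop => ?_
  have h3 := (h x r hr).2.2
  rw [htop, ENNReal.mul_top (by simpa using zero_lt_one.trans hCd)] at h3
  exact lt_irrefl _ h3

theorem MemRHInfty.exists_ae_le (hw : MemRHInfty μ w) : ∃ K : ℝ, 0 ≤ K ∧ ∀ (x : X) (r : ℝ),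
    0 < r → ∀ᵐ y ∂μ.restrict (ball x r), w y ≤ K * ⨍ z in ball x r, w z ∂μ := by
  obtain ⟨C, hC⟩ := hw.reverse_holder
  -- A nonnegative constant makes the right side nonnegative, so that `ENNReal.ofReal` can be
  -- removed.
  refine ⟨max C 0, le_max_right _ _, fun x r hr => ?_⟩
  have havg : 0 ≤ ⨍ z in ball x r, w z ∂μ :=
    integral_nonneg_of_ae (Measure.ae_smul_measure (ae_restrict_of_ae hw.nonneg) _)
  filter_upwards [ENNReal.ae_le_essSup (fun y => ENNReal.ofReal (w y))] with y hy
  refine (ENNReal.ofReal_le_ofReal_iff (mul_nonneg (le_max_right _ _) havg)).1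
    ((hy.trans (hC x r hr)).trans (ENNReal.ofReal_le_ofReal ?_))
  gcongr
  exact le_max_left _ _

/-- Local integrability together with the reverse Hölder inequality gives integrability on every
ball: if it failed, the average would be `0` and hence `w = 0` a.e. on the ball. -/
theorem MemRHInfty.integrableOn_ball (hw : MemRHInfty μ w) (x : X) {r : ℝ} (hr : 0 < r) :
    IntegrableOn w (ball x r) μ := by
  by_contra hni
  obtain ⟨K, -, hK⟩ := hw.exists_ae_le
  have havg : ⨍ z in ball x r, w z ∂μ = 0 := by
    rw [setAverage_eq, integral_undef hni, smul_zero]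
  have hzero : w =ᵐ[μ.restrict (ball x r)] 0 := by
    filter_upwards [hK x r hr, ae_restrict_of_ae hw.nonneg] with y hy hy0
    rw [havg, mul_zero] at hy
    exact le_antisymm hy hy0
  exact hni ((integrable_zero X ℝ _).congr hzero.symm)

theorem IsDoubling.memRHInfty_one (hμ : IsDoubling μ) :
    MemRHInfty μ (fun _ => 1) where
  locallyIntegrable x := ⟨ball x 1, ball_mem_nhds x one_pos,
    integrableOn_const (hμ.measure_ball_lt_top x one_pos).ne⟩
  nonneg := .of_forall fun _ => zero_le_one
  reverse_holder := ⟨1, fun x r hr => by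
    rw [setAverage_const (hμ.measure_ball_pos x hr).ne' (hμ.measure_ball_lt_top x hr).ne, mul_one]
    exact essSup_le_of_ae_le _ (.of_forall fun _ => le_rfl)⟩

/-- `φ` is essentially bounded on each ball, and `w` is integrable there. -/
theorem MemRHInfty.integrableOn_ball_mul (hφ : MemRHInfty μ φ) (hw : MemRHInfty μ w) (x : X)
    {r : ℝ} (hr : 0 < r) : IntegrableOn (fun y => φ y * w y) (ball x r) μ := by
  obtain ⟨K, -, hK⟩ := hφ.exists_ae_le
  refine (hw.integrableOn_ball x hr).bdd_mul
    (c := K * ⨍ z in ball x r, φ z ∂μ) (hφ.integrableOn_ball x hr).aestronglyMeasurable ?_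
  filter_upwards [hK x r hr, ae_restrict_of_ae hφ.nonneg] with y hy hy0
  rwa [Real.norm_of_nonneg hy0]

theorem MemRHInfty.mul (hμ : IsDoubling μ) (hφA : MemAInfty μ φ) (hφ : MemRHInfty μ φ)
    (hw : MemRHInfty μ w) : MemRHInfty μ (fun x => φ x * w x) where
  locallyIntegrable x := ⟨ball x 1, ball_mem_nhds x one_pos, hφ.integrableOn_ball_mul hw x one_pos⟩
  nonneg := by
    filter_upwards [hφ.nonneg, hw.nonneg] with x h1 h2 using mul_nonneg h1 h2
  reverse_holder := by
    obtain ⟨C, hC⟩ := hφA.reverse_jensen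
    obtain ⟨L, hL0, hL⟩ := hφ.exists_ae_le
    obtain ⟨K, hK0, hK⟩ := hw.exists_ae_le
    set t := K * (1 + Real.log C) with ht
    -- `L` and `K` come from the two sup bounds, `exp t` from the decoupling.
    refine ⟨L * K * Real.exp t, fun x r hr => ?_⟩
    set ν := μ.restrict (ball x r) with hν
    have hν_pos : ν Set.univ ≠ 0 := by
      simpa [hν] using (hμ.measure_ball_pos x hr).ne'
    have hν_top : ν Set.univ ≠ ⊤ := by
      simpa [hν] using (hμ.measure_ball_lt_top x hr).ne
    have : IsFiniteMeasure ν := ⟨hν_top.lt_top⟩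
    have : NeZero ν := ⟨fun h => hν_pos (by simp [h])⟩
    have hc : (ν Set.univ)⁻¹ ≠ ⊤ := ENNReal.inv_ne_top.2 hν_pos
    have key : Real.exp (-t) * ((⨍ y in ball x r, φ y ∂μ) * ⨍ y in ball x r, w y ∂μ) ≤
        ⨍ y in ball x r, φ y * w y ∂μ :=
      -- Averages over the ball are by definition integrals against this probability measure.
      exp_mul_integral_mul_integral_le (P := (ν Set.univ)⁻¹ • ν)
        ((hφ.integrableOn_ball x hr).smul_measure hc)
        (Measure.ae_smul_measure (ae_restrict_of_ae hφA.pos) _)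
        ((hφA.log_integrableOn x r hr).smul_measure hc) (hC x r hr)
        ((hw.integrableOn_ball x hr).smul_measure hc)
        (Measure.ae_smul_measure (ae_restrict_of_ae hw.nonneg) _)
        (Measure.ae_smul_measure (hK x r hr) _)
        ((hφ.integrableOn_ball_mul hw x hr).smul_measure hc)
    refine essSup_le_of_ae_le _ ?_
    filter_upwards [hL x r hr, hK x r hr, ae_restrict_of_ae hφ.nonneg,
      ae_restrict_of_ae hw.nonneg] with y hφy hwy hφy0 hwy0
    refine ENNReal.ofReal_le_ofReal ?_
    calc φ y * w y
        ≤ (L * ⨍ y in ball x r, φ y ∂μ) * (K * ⨍ y in ball x r, w y ∂μ) :=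
          mul_le_mul hφy hwy hwy0 (hφy0.trans hφy)
      _ = L * K * Real.exp t *
          (Real.exp (-t) * ((⨍ y in ball x r, φ y ∂μ) * ⨍ y in ball x r, w y ∂μ)) := by
          rw [Real.exp_neg]
          field_simp
      _ ≤ L * K * Real.exp t * ⨍ y in ball x r, φ y * w y ∂μ := by gcongr

end

theorem mainTheorem6 {X : Type*} [MetricSpace X] [CompleteSpace X] [MeasurableSpace X]
    [BorelSpace X] (μ : Measure X) (hμ : IsDoubling μ) (hX : HasAnnularDecay μ)
    (φ : X → ℝ) (hφ : MemAInfty μ φ) :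
    IsMultiplierRHInfty μ φ ↔ MemRHInfty μ φ := by
  refine ⟨fun h => ?_, fun h w hw => h.mul hμ hφ hw⟩
  simpa using h _ hμ.memRHInfty_one
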